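/- **Lemma 3.12.** Let $a<b$, $c<d$, $0<\gamma<1$ and $u\in C^6([a,b]\times[c,d])$. For integers $M_x,M_y\ge 1$ put $h_x=(b-a)/M_x$, $h_y=(d-c)/M_y$, $x_{k/2}=a+\tfrac{k}{2}h_x$, $y_{k/2}=c+\tfrac{k}{2}h_y$. For $x\in[a,b]$ let $\phi_{l}$ ($0\le l\le M_x$) and $\phi_{l-1/2}$ ($1\le l\le M_x$) be the piecewise quadratic basis functions $$\phi_l(x)=\begin{cases}\frac{x-x_{l-1}}{h_x}\cdot\frac{2x-(x_l+x_{l-1})}{h_x}, & x\in[x_{l-1},x_l],\\[2pt] \frac{x_{l+1}-x}{h_x}\cdot\frac{(x_{l+1}+x_l)-2x}{h_x}, & x\in[x_l,x_{l+1}],\\ 0,&\text{otherwise,}\end{cases}\qquad \phi_{l-\frac12}(x)=\begin{cases}\frac{4(x-x_{l-1})(x_l-x)}{h_x^2}, & x\in[x_{l-1},x_l],\\ 0,&\text{otherwise}\end{cases}$$ (for $l=0$ and $l=M_x$ only the piece lying in $[a,b]$ counts), and define the basis functions $\tilde\phi_{r/2}(y)$, $0\le r\le 2M_y$, on $[c,d]$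 in the same way. Let $$u_Q(x,y)=\sum_{l=0}^{2M_x}\sum_{r=0}^{2M_y}\phi_{\frac l2}(x)\,\tilde\phi_{\frac r2}(y)\,u\big(x_{\frac l2},y_{\frac r2}\big)$$ be the piecewise biquadratic Lagrange interpolant of $u$. Then there is a constant $C$, depending only on $a,b,c,d,\gamma,u$, such that for all $M_x,M_y\ge1$ and all $1\le i\le 2M_x-1$, $1\le j\le 2M_y-1$ the integrand below is integrable on $[a,b]\times[c,d]$ and $$\left|\int_c^d\!\int_a^b \frac{u(x,y)-u_Q(x,y)}{\left|\sqrt{(x_{\frac i2}-x)^2+(y_{\frac j2}-y)^2}\right|^{\gamma}}\,dx\,dy\right|\le C\Big(h_x^4\,\eta_{\frac i2}^{-\gamma}+h_y^4\,\tilde\eta_{\frac j2}^{-\gamma}\Big)+C\big(h_x^{5-\gamma}+h_y^{5-\gamma}\big),$$ where $\eta_{i/2}=\min\{x_{i/2}-a,\;b-x_{i/2}\}$ and $\tilde\eta_{j/2}=\min\{y_{j/2}-c,\;d-y_{j/2}\}$. -/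

import Mathlib

/-- The uniform step size `h = (b - a) / M`. -/
noncomputable def meshSize (a b : ℝ) (M : ℕ) : ℝ := (b - a) / M

/-- The mesh point `x_{k/2} = a + (k/2) h`. The points of the partition of `[a, b]` are those with
`0 ≤ k ≤ 2 M`; other values of `k` only name the end points of the outer halves of the supports of
the first and the last basis function, which lie outside `[a, b]`. -/
noncomputable def halfNode (a b : ℝ) (M : ℕ) (k : ℤ) : ℝ := a + (k : ℝ) / 2 * meshSize a b M

/-- The piecewise quadratic basis function `φ_{k/2}`. For even `k = 2 l` it is the function `φ_l`
attached to the cell end point `x_l`, with pieces `φ_l^-` on `[x_{l-1}, x_l]` and `φ_l^+` on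
`[x_l, x_{l+1}]`; for odd `k = 2 l - 1` it is the bubble `φ_{l-1/2}` on `[x_{l-1}, x_l]`.
On `[a, b]`, `φ_0` reduces to its right piece and `φ_M` to its left piece. -/
noncomputable def quadBasis (a b : ℝ) (M : ℕ) (k : ℤ) (x : ℝ) : ℝ :=
  if Even k then
    if x ∈ Set.Icc (halfNode a b M (k - 2)) (halfNode a b M k) then
      (x - halfNode a b M (k - 2)) / meshSize a b M *
        ((2 * x - (halfNode a b M k + halfNode a b M (k - 2))) / meshSize a b M)
    else if x ∈ Set.Icc (halfNode a b M k) (halfNode a b M (k + 2)) then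
      (halfNode a b M (k + 2) - x) / meshSize a b M *
        (((halfNode a b M (k + 2) + halfNode a b M k) - 2 * x) / meshSize a b M)
    else 0
  else
    if x ∈ Set.Icc (halfNode a b M (k - 1)) (halfNode a b M (k + 1)) then
      4 * (x - halfNode a b M (k - 1)) * (halfNode a b M (k + 1) - x) / meshSize a b M ^ 2
    else 0

/-- The piecewise (bi)quadratic Lagrange interpolant `u_Q` of `u` on `[a, b] × [c, d]`. -/
noncomputable def quadInterp (a b c d : ℝ) (Mx My : ℕ) (u : ℝ × ℝ → ℝ) (x y : ℝ) : ℝ :=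
  ∑ l ∈ Finset.range (2 * Mx + 1), quadBasis a b Mx l x *
    ∑ r ∈ Finset.range (2 * My + 1), quadBasis c d My r y *
      u (halfNode a b Mx l, halfNode c d My r)

/-- The distance `η_{k/2} = min {x_{k/2} - a, b - x_{k/2}}` of a mesh point to the end points. -/
noncomputable def endDist (a b : ℝ) (M : ℕ) (k : ℤ) : ℝ :=
  min (halfNode a b M k - a) (b - halfNode a b M k)

/-- The interpolation error weighted with the additive kernel centred at `(x_{i/2}, y_{j/2})`. -/
noncomputable def additiveErrorIntegrand (a b c d γ : ℝ) (Mx My : ℕ) (u : ℝ × ℝ → ℝ) (i j : ℤ)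
    (x y : ℝ) : ℝ :=
  (u (x, y) - quadInterp a b c d Mx My u x y) /
    |Real.sqrt ((halfNode a b Mx i - x) ^ 2 + (halfNode c d My j - y) ^ 2)| ^ γ

/-!
On a cell of size `h` the error of quadratic interpolation of a `C⁴` function is
`κ h³ ω((x - p) / h) + O(h⁴)`, where `ω(t) = t (t - 1/2) (t - 1)` has mean zero. Against a weight of
bounded variation the cubic term therefore only sees the oscillation of the weight on the cell,
and these oscillations add up to the total variation: the weighted error over `[a, b]` is
`O(h⁴)` times the supremum plus the variation of the weight. For fixed `y` the kernel is unimodal in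
`x`, so both are at most a multiple of `|y₀ - y| ^ (-γ)`, which is integrable because `γ < 1`.

In two variables, interpolate first in `y` and then in `x`. The first error is the one-dimensional
one on vertical lines; the second is the one-dimensional error of the semi-discrete interpolant,
whose `x`-derivatives are interpolants of those of `u`, hence bounded. The resulting `O(hx⁴ + hy⁴)`
is uniform in the centre of the kernel, and the weights `η ^ (-γ)` are bounded below.
-/

open MeasureTheory Set

section Mesh

variable {a b : ℝ} {M : ℕ}

theorem meshSize_pos (hab : a < b) (hM : 1 ≤ M) : 0 < meshSize a b M :=
  div_pos (sub_pos.2 hab) (by exact_mod_cast hM)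

theorem natCast_mul_meshSize (hM : 1 ≤ M) : M * meshSize a b M = b - a :=
  mul_div_cancel₀ _ (by positivity)

theorem halfNode_mem_Icc (hab : a < b) (hM : 1 ≤ M) {k : ℕ} (hk : k ≤ 2 * M) :
    halfNode a b M k ∈ Icc a b := by
  have h := meshSize_pos hab hM
  have hMh := natCast_mul_meshSize (a := a) (b := b) hM
  have hk' : (k : ℝ) ≤ 2 * M := by exact_mod_cast hk
  have : (0 : ℝ) ≤ k := k.cast_nonneg
  simp only [halfNode, Int.cast_natCast]
  constructor <;> nlinarith

theorem cell_subset_Icc (hab : a < b) (hM : 1 ≤ M) {n : ℕ} (hn : n < M) :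
    Icc (a + n * meshSize a b M) (a + n * meshSize a b M + meshSize a b M) ⊆ Icc a b := by
  have h := meshSize_pos hab hM
  have hMh := natCast_mul_meshSize (a := a) (b := b) hM
  have hn' : (n : ℝ) + 1 ≤ M := by exact_mod_cast hn
  have : (0 : ℝ) ≤ n := n.cast_nonneg
  exact Icc_subset_Icc (by nlinarith) (by nlinarith)

theorem exists_cell_of_mem_Icc (hab : a < b) (hM : 1 ≤ M) {x : ℝ} (hx : x ∈ Icc a b) :
    ∃ n < M, ∃ t ∈ Icc (0 : ℝ) 1, x = a + n * meshSize a b M + t * meshSize a b M := by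
  have h := meshSize_pos hab hM
  have hMh := natCast_mul_meshSize (a := a) (b := b) hM
  obtain ⟨s, rfl⟩ : ∃ s, x = a + s * meshSize a b M :=
    ⟨(x - a) / meshSize a b M, by rw [div_mul_cancel₀ _ h.ne']; ring⟩
  have hs0 : 0 ≤ s := nonneg_of_mul_nonneg_left (by linarith [hx.1]) h
  have hsM : s ≤ M := le_of_mul_le_mul_right (by linarith [hx.2]) h
  rcases hsM.eq_or_lt with rfl | hlt
  · refine ⟨M - 1, by omega, 1, by simp, ?_⟩
    push_cast [Nat.cast_sub hM]
    ring
  · exact ⟨⌊s⌋₊, (Nat.floor_lt hs0).2 hlt, s - ⌊s⌋₊,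
      ⟨by linarith [Nat.floor_le hs0], by linarith [Nat.lt_floor_add_one s]⟩, by ring⟩

theorem quadBasis_two_mul (h : 0 < meshSize a b M) (m : ℤ) (s : ℝ) :
    quadBasis a b M (2 * m) (a + s * meshSize a b M) =
      max 0 (1 - |s - m|) * (1 - 2 * |s - m|) := by
  rw [quadBasis, if_pos (even_two_mul m)]
  simp only [halfNode, mem_Icc, add_le_add_iff_left, mul_le_mul_iff_left₀ h]
  push_cast
  generalize meshSize a b M = H at *
  split_ifs with hl hr
  · rw [abs_of_nonpos (by linarith), max_eq_right (by linarith)]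
    field_simp
    ring
  · rw [abs_of_nonneg (by linarith), max_eq_right (by linarith)]
    field_simp
    ring
  · rw [max_eq_left, zero_mul]
    by_contra! hlt
    obtain ⟨h₁, h₂⟩ := abs_lt.1 (sub_pos.1 hlt)
    rcases le_total s m with hs | hs
    · exact hl ⟨by linarith, by linarith⟩
    · exact hr ⟨by linarith, by linarith⟩

theorem quadBasis_two_mul_add_one (h : 0 < meshSize a b M) (m : ℤ) (s : ℝ) :
    quadBasis a b M (2 * m + 1) (a + s * meshSize a b M) = max 0 (4 * (s - m) * (m + 1 - s)) := by
  rw [quadBasis, if_neg (Int.not_even_two_mul_add_one m)]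
  simp only [halfNode, mem_Icc, add_le_add_iff_left, mul_le_mul_iff_left₀ h]
  push_cast
  generalize meshSize a b M = H at *
  split_ifs with hs
  · rw [max_eq_right (mul_nonneg (by linarith) (by linarith))]
    field_simp
    ring
  · rw [max_eq_left]
    by_contra! hlt
    exact hs ⟨by nlinarith, by nlinarith⟩

theorem continuous_quadBasis (h : 0 < meshSize a b M) (k : ℤ) : Continuous (quadBasis a b M k) := by
  suffices hk : Continuous fun s => quadBasis a b M k (a + s * meshSize a b M) by
    simpa only [Function.comp_def, div_mul_cancel₀ _ h.ne', add_sub_cancel] using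
      hk.comp (by fun_prop : Continuous fun x => (x - a) / meshSize a b M)
  obtain ⟨m, rfl | rfl⟩ := k.even_or_odd'
  · simp_rw [quadBasis_two_mul h]
    fun_prop
  · simp_rw [quadBasis_two_mul_add_one h]
    fun_prop

theorem quadBasis_eq_zero (h : 0 < meshSize a b M) {k n : ℤ} (hk : k < 2 * n ∨ 2 * n + 2 < k)
    {s : ℝ} (hs : s ∈ Icc (n : ℝ) (n + 1)) : quadBasis a b M k (a + s * meshSize a b M) = 0 := by
  obtain ⟨hs₁, hs₂⟩ := hs
  obtain ⟨m, rfl | rfl⟩ := k.even_or_odd'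
  · rw [quadBasis_two_mul h, max_eq_left, zero_mul]
    rcases hk with hk | hk
    · have : (m : ℝ) + 1 ≤ n := by exact_mod_cast (by omega : m + 1 ≤ n)
      linarith [le_abs_self (s - m)]
    · have : (n : ℝ) + 2 ≤ m := by exact_mod_cast (by omega : n + 2 ≤ m)
      linarith [neg_le_abs (s - m)]
  · rw [quadBasis_two_mul_add_one h, max_eq_left]
    rcases hk with hk | hk
    · have : (m : ℝ) + 1 ≤ n := by exact_mod_cast (by omega : m + 1 ≤ n)
      nlinarith
    · have : (n : ℝ) + 1 ≤ m := by exact_mod_cast (by omega : n + 1 ≤ m)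
      nlinarith

theorem quadBasis_cell_left (h : 0 < meshSize a b M) (n : ℤ) {t : ℝ} (ht : t ∈ Icc (0 : ℝ) 1) :
    quadBasis a b M (2 * n) (a + (n + t) * meshSize a b M) = (1 - t) * (1 - 2 * t) := by
  rw [quadBasis_two_mul h, add_sub_cancel_left, abs_of_nonneg ht.1,
    max_eq_right (sub_nonneg.2 ht.2)]

theorem quadBasis_cell_mid (h : 0 < meshSize a b M) (n : ℤ) {t : ℝ} (ht : t ∈ Icc (0 : ℝ) 1) :
    quadBasis a b M (2 * n + 1) (a + (n + t) * meshSize a b M) = 4 * t * (1 - t) := by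
  rw [quadBasis_two_mul_add_one h, add_sub_cancel_left, add_sub_add_left_eq_sub,
    max_eq_right (by nlinarith [ht.1, ht.2])]

theorem quadBasis_cell_right (h : 0 < meshSize a b M) (n : ℤ) {t : ℝ} (ht : t ∈ Icc (0 : ℝ) 1) :
    quadBasis a b M (2 * n + 2) (a + (n + t) * meshSize a b M) = t * (2 * t - 1) := by
  rw [← mul_add_one, quadBasis_two_mul h, Int.cast_add, Int.cast_one, add_sub_add_left_eq_sub,
    abs_of_nonpos (sub_nonpos.2 ht.2), max_eq_right (by linarith [ht.1])]
  ring

end Mesh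

section Interpolation

variable {a b : ℝ} {M : ℕ} {f : ℝ → ℝ}

/-- The quadratic polynomial in `t` with the values `A`, `B`, `D` at `t = 0`, `1 / 2`, `1`. -/
def quadLagrange (A B D t : ℝ) : ℝ :=
  (1 - t) * (1 - 2 * t) * A + 4 * t * (1 - t) * B + t * (2 * t - 1) * D

/-- `5 / 4` is the Lebesgue constant of quadratic interpolation at equidistant nodes. -/
theorem abs_quadLagrange_le {t A B D W : ℝ} (ht : t ∈ Icc (0 : ℝ) 1) (hA : |A| ≤ W) (hB : |B| ≤ W)
    (hD : |D| ≤ W) : |quadLagrange A B D t| ≤ 5 / 4 * W := by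
  obtain ⟨h0, h1⟩ := ht
  have hW : 0 ≤ W := (abs_nonneg A).trans hA
  have hsum : |(1 - t) * (1 - 2 * t)| + |4 * t * (1 - t)| + |t * (2 * t - 1)| ≤ 5 / 4 := by
    rw [abs_of_nonneg (by nlinarith : 0 ≤ 4 * t * (1 - t)), abs_mul, abs_mul,
      abs_of_nonneg h0, abs_of_nonneg (sub_nonneg.2 h1), abs_sub_comm 1 (2 * t)]
    rcases le_total (2 * t) 1 with ht | ht
    · rw [abs_of_nonpos (sub_nonpos.2 ht)]
      nlinarith [sq_nonneg (4 * t - 1)]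
    · rw [abs_of_nonneg (sub_nonneg.2 ht)]
      nlinarith [sq_nonneg (4 * t - 3)]
  calc |quadLagrange A B D t|
      ≤ |(1 - t) * (1 - 2 * t)| * |A| + |4 * t * (1 - t)| * |B| + |t * (2 * t - 1)| * |D| := by
        simp only [quadLagrange, ← abs_mul _ A, ← abs_mul _ B, ← abs_mul _ D]
        exact abs_add_three _ _ _
    _ ≤ |(1 - t) * (1 - 2 * t)| * W + |4 * t * (1 - t)| * W + |t * (2 * t - 1)| * W := by gcongr
    _ ≤ 5 / 4 * W := by rw [← add_mul, ← add_mul]; gcongr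

/-- The piecewise quadratic Lagrange interpolant of a function of one variable. The interpolant
`quadInterp` is its tensor product: it interpolates in the second variable, then in the first. -/
noncomputable def lineInterp (a b : ℝ) (M : ℕ) (f : ℝ → ℝ) (x : ℝ) : ℝ :=
  ∑ l ∈ Finset.range (2 * M + 1), quadBasis a b M l x * f (halfNode a b M l)

theorem quadInterp_eq_lineInterp (a b c d : ℝ) (Mx My : ℕ) (u : ℝ × ℝ → ℝ) (x y : ℝ) :
    quadInterp a b c d Mx My u x y =
      lineInterp a b Mx (fun s => lineInterp c d My (fun t => u (s, t)) y) x := rfl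

theorem lineInterp_cell (h : 0 < meshSize a b M) {n : ℕ} (hn : n < M) {t : ℝ}
    (ht : t ∈ Icc (0 : ℝ) 1) (f : ℝ → ℝ) :
    lineInterp a b M f (a + n * meshSize a b M + t * meshSize a b M) =
      quadLagrange (f (a + n * meshSize a b M))
        (f (a + n * meshSize a b M + meshSize a b M / 2))
        (f (a + n * meshSize a b M + meshSize a b M)) t := by
  have hactive : Finset.Icc (2 * n) (2 * n + 2) ⊆ Finset.range (2 * M + 1) := fun l hl => by
    simp only [Finset.mem_Icc, Finset.mem_range] at hl ⊢
    omega
  have hinactive : ∀ l ∈ Finset.range (2 * M + 1), l ∉ Finset.Icc (2 * n) (2 * n + 2) →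
      quadBasis a b M l (a + (n + t) * meshSize a b M) * f (halfNode a b M l) = 0 := by
    intro l _ hl
    rw [Finset.mem_Icc] at hl
    have hs : (n + t : ℝ) ∈ Icc ((n : ℤ) : ℝ) ((n : ℤ) + 1) := by
      simpa only [Int.cast_natCast, mem_Icc, le_add_iff_nonneg_right, add_le_add_iff_left] using ht
    rw [quadBasis_eq_zero h (by omega) hs, zero_mul]
  have hleft := quadBasis_cell_left h n ht
  have hmid := quadBasis_cell_mid h n ht
  have hright := quadBasis_cell_right h n ht
  norm_cast at hleft hmid hright
  rw [add_assoc, ← add_mul, lineInterp, ← Finset.sum_subset hactive hinactive,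
    Finset.sum_Icc_succ_top (by omega), Finset.sum_Icc_succ_top (by omega), Finset.Icc_self,
    Finset.sum_singleton, hleft, hmid, hright, quadLagrange]
  simp only [halfNode]
  push_cast
  ring_nf

theorem abs_lineInterp_le (hab : a < b) (hM : 1 ≤ M) {W : ℝ} (hf : ∀ x ∈ Icc a b, |f x| ≤ W)
    {x : ℝ} (hx : x ∈ Icc a b) : |lineInterp a b M f x| ≤ 5 / 4 * W := by
  have h := meshSize_pos hab hM
  obtain ⟨n, hn, t, ht, rfl⟩ := exists_cell_of_mem_Icc hab hM hx
  have hcell := cell_subset_Icc hab hM hn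
  rw [lineInterp_cell h hn ht]
  exact abs_quadLagrange_le ht (hf _ (hcell ⟨by linarith, by linarith⟩))
    (hf _ (hcell ⟨by linarith, by linarith⟩)) (hf _ (hcell ⟨by linarith, by linarith⟩))

theorem continuous_lineInterp (h : 0 < meshSize a b M) (f : ℝ → ℝ) :
    Continuous (lineInterp a b M f) :=
  continuous_finsetSum _ fun l _ => (continuous_quadBasis h l).mul continuous_const

end Interpolation

section CellError

variable {f : ℝ → ℝ} {a b K p h : ℝ}

/-- `f` is four times continuously differentiable on `[a, b]`, with third and fourth derivative
bounded by `K`. This is the regularity that quadratic interpolation sees. -/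
structure HasC4Bound (f : ℝ → ℝ) (a b K : ℝ) : Prop where
  contDiffOn : ContDiffOn ℝ 4 f (Icc a b)
  third_le : ∀ x ∈ Icc a b, |iteratedDerivWithin 3 f (Icc a b) x| ≤ K
  fourth_le : ∀ x ∈ Icc a b, |iteratedDerivWithin 4 f (Icc a b) x| ≤ K

theorem HasC4Bound.nonneg (hf : HasC4Bound f a b K) (hab : a ≤ b) : 0 ≤ K :=
  (abs_nonneg _).trans (hf.third_le a (left_mem_Icc.2 hab))

theorem HasC4Bound.mono {p q : ℝ} (hf : HasC4Bound f a b K) (hpq : p < q)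
    (hsub : Icc p q ⊆ Icc a b) : HasC4Bound f p q K := by
  have hab : a < b := (nonempty_Ioo.1 <| (nonempty_Ioo.2 hpq).mono <| by
    simpa only [interior_Icc] using interior_mono hsub)
  have heq {n : ℕ} (hn : (n : WithTop ℕ∞) ≤ 4) {x : ℝ} (hx : x ∈ Icc p q) :
      iteratedDerivWithin n f (Icc p q) x = iteratedDerivWithin n f (Icc a b) x := by
    simp only [iteratedDerivWithin, iteratedFDerivWithin_subset hsub (uniqueDiffOn_Icc hpq)
      (uniqueDiffOn_Icc hab) (hf.contDiffOn.of_le hn) hx]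
  refine ⟨hf.contDiffOn.mono hsub, fun x hx => ?_, fun x hx => ?_⟩
  · rw [heq (by norm_num) hx]
    exact hf.third_le x (hsub hx)
  · rw [heq (by norm_num) hx]
    exact hf.fourth_le x (hsub hx)

theorem HasC4Bound.abs_sub_taylor_le (hf : HasC4Bound f p (p + h) K) (hh : 0 ≤ h) :
    ∃ c₁ c₂ κ : ℝ, |κ| ≤ K / 6 ∧ ∀ t ∈ Icc (0 : ℝ) 1,
      |f (p + t * h) - (f p + c₁ * t + c₂ * t ^ 2 + κ * h ^ 3 * t ^ 3)| ≤ K / 6 * h ^ 4 := by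
  have hp : p ∈ Icc p (p + h) := left_mem_Icc.2 (by linarith)
  have hK : 0 ≤ K := hf.nonneg (by linarith)
  refine ⟨derivWithin f (Icc p (p + h)) p * h,
    iteratedDerivWithin 2 f (Icc p (p + h)) p / 2 * h ^ 2,
    iteratedDerivWithin 3 f (Icc p (p + h)) p / 6, ?_, fun t ht => ?_⟩
  · rw [abs_div, abs_of_pos (by norm_num : (0 : ℝ) < 6)]
    gcongr
    exact hf.third_le p hp
  have hT := taylor_mean_remainder_bound (n := 3) (by linarith) hf.contDiffOn
    (x := p + t * h) ⟨by nlinarith [ht.1], by nlinarith [ht.2]⟩ hf.fourth_le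
  simp only [taylorWithinEval_succ, taylor_within_zero_eval, smul_eq_mul, Real.norm_eq_abs,
    add_sub_cancel_left] at hT
  norm_num [Nat.factorial] at hT
  calc _ = _ := by congr 1; ring
    _ ≤ K * (t * h) ^ 4 / 6 := hT
    _ ≤ K * h ^ 4 / 6 := by
      have : 0 ≤ t * h := mul_nonneg ht.1 hh
      gcongr
      exact mul_le_of_le_one_left hh ht.2
    _ = K / 6 * h ^ 4 := by ring

/-- The monic cubic vanishing at the three interpolation nodes `0`, `1 / 2`, `1` of the reference
cell, i.e. the error of quadratic interpolation of `t ↦ t ^ 3`. -/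
noncomputable def nodalCubic (t : ℝ) : ℝ := t * (t - 1 / 2) * (t - 1)

theorem abs_nodalCubic_le_one {t : ℝ} (ht : t ∈ Icc (0 : ℝ) 1) : |nodalCubic t| ≤ 1 := by
  obtain ⟨h0, h1⟩ := ht
  have hfactor (c : ℝ) (hc : c ∈ Icc (0 : ℝ) 1) : |t - c| ≤ 1 :=
    abs_le.2 ⟨by linarith [hc.2], by linarith [hc.1]⟩
  rw [nodalCubic, abs_mul, abs_mul, abs_of_nonneg h0]
  exact mul_le_one₀ (mul_le_one₀ h1 (abs_nonneg _) (hfactor _ (by norm_num))) (abs_nonneg _)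
    (hfactor _ (by norm_num))

theorem integral_nodalCubic_cell (hh : h ≠ 0) (p : ℝ) :
    ∫ x in p..p + h, nodalCubic ((x - p) / h) = 0 := by
  have hodd (t : ℝ) : nodalCubic (1 - t) = -nodalCubic t := by rw [nodalCubic, nodalCubic]; ring
  have hunit : ∫ t in (0 : ℝ)..1, nodalCubic t = 0 := by
    have hreflect := intervalIntegral.integral_comp_sub_left nodalCubic (a := 0) (b := 1) 1
    simp only [hodd, intervalIntegral.integral_neg, sub_self, sub_zero] at hreflect
    linarith
  simp only [sub_div]
  rw [intervalIntegral.integral_comp_div_sub _ hh, ← sub_div, sub_self, zero_div, ← sub_div,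
    add_sub_cancel_left, div_self hh, hunit, smul_zero]

theorem HasC4Bound.exists_abs_interpError_sub_le (hf : HasC4Bound f p (p + h) K) (hh : 0 ≤ h) :
    ∃ κ, |κ| ≤ K ∧ ∀ t ∈ Icc (0 : ℝ) 1,
      |f (p + t * h) - quadLagrange (f p) (f (p + h / 2)) (f (p + h)) t -
        κ * h ^ 3 * nodalCubic t| ≤ K * h ^ 4 := by
  obtain ⟨c₁, c₂, κ, hκ, hT⟩ := hf.abs_sub_taylor_le hh
  have hK : 0 ≤ K := by linarith [(abs_nonneg κ).trans hκ]
  refine ⟨κ, by linarith, fun t ht => ?_⟩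
  set R : ℝ → ℝ := fun t => f (p + t * h) - (f p + c₁ * t + c₂ * t ^ 2 + κ * h ^ 3 * t ^ 3)
  have hR : |quadLagrange (R 0) (R (1 / 2)) (R 1) t| ≤ 5 / 4 * (K / 6 * h ^ 4) :=
    abs_quadLagrange_le ht (hT 0 (by norm_num)) (hT (1 / 2) (by norm_num)) (hT 1 (by norm_num))
  calc _ = |R t - quadLagrange (R 0) (R (1 / 2)) (R 1) t| := by
        simp only [R, quadLagrange, nodalCubic, one_div_mul_eq_div, zero_mul, one_mul, add_zero]
        congr 1
        ring
    _ ≤ K / 6 * h ^ 4 + 5 / 4 * (K / 6 * h ^ 4) := (abs_sub _ _).trans (add_le_add (hT t ht) hR)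
    _ ≤ K * h ^ 4 := by nlinarith [mul_nonneg hK (pow_nonneg hh 4)]

end CellError

section WeightedError

variable {a b p h K W : ℝ} {M : ℕ} {f e v : ℝ → ℝ}

theorem intervalIntegrable_of_boundedVariationOn (hab : a ≤ b)
    (hv : BoundedVariationOn v (Icc a b)) : IntervalIntegrable v volume a b := by
  obtain ⟨q, r, hq, hr, rfl, -⟩ :=
    hv.locallyBoundedVariationOn.exists_monotoneOn_sub_monotoneOn'
  rw [← uIcc_of_le hab] at hq hr
  exact hq.intervalIntegrable.sub hr.intervalIntegrable

/-- The cubic part of the error has mean zero, so against it the weight may be replaced by its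
deviation from the value at the left end point. -/
theorem abs_integral_mul_cell_le (hh : 0 < h) {κ : ℝ} (hκ : |κ| ≤ K)
    (he : ContinuousOn e (Icc p (p + h)))
    (hcubic : ∀ t ∈ Icc (0 : ℝ) 1, |e (p + t * h) - κ * h ^ 3 * nodalCubic t| ≤ K * h ^ 4)
    (hv : BoundedVariationOn v (Icc p (p + h))) (hW : ∀ x ∈ Icc p (p + h), |v x| ≤ W) :
    |∫ x in p..p + h, v x * e x| ≤
      K * h ^ 4 * (h * W + (eVariationOn v (Icc p (p + h))).toReal) := by
  have hle : p ≤ p + h := by linarith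
  have hp : p ∈ Icc p (p + h) := left_mem_Icc.2 hle
  have hK : 0 ≤ K := (abs_nonneg κ).trans hκ
  have hve : IntervalIntegrable (fun x => v x * e x) volume p (p + h) :=
    (intervalIntegrable_of_boundedVariationOn hle hv).mul_continuousOn (by rwa [uIcc_of_le hle])
  have hsub : ∫ x in p..p + h, v x * e x =
      ∫ x in p..p + h, (v x * e x - v p * κ * h ^ 3 * nodalCubic ((x - p) / h)) := by
    rw [intervalIntegral.integral_sub hve (Continuous.intervalIntegrable
      (by unfold nodalCubic; fun_prop) _ _), intervalIntegral.integral_const_mul,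
      integral_nodalCubic_cell hh.ne', mul_zero, sub_zero]
  have hbound : ∀ x ∈ Icc p (p + h),
      ‖v x * e x - v p * κ * h ^ 3 * nodalCubic ((x - p) / h)‖ ≤
        W * (K * h ^ 4) + (eVariationOn v (Icc p (p + h))).toReal * (K * h ^ 3 * 1) := by
    intro x hx
    have ht : (x - p) / h ∈ Icc (0 : ℝ) 1 :=
      ⟨div_nonneg (by linarith [hx.1]) hh.le, (div_le_one hh).2 (by linarith [hx.2])⟩
    have hrem := hcubic _ ht
    rw [div_mul_cancel₀ _ hh.ne', add_sub_cancel] at hrem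
    have hvar : |v x - v p| ≤ (eVariationOn v (Icc p (p + h))).toReal := hv.dist_le hx hp
    have hn := abs_nodalCubic_le_one ht
    generalize nodalCubic ((x - p) / h) = q at *
    calc ‖v x * e x - v p * κ * h ^ 3 * q‖
        = |v x * (e x - κ * h ^ 3 * q) + (v x - v p) * (κ * h ^ 3 * q)| := by
          rw [Real.norm_eq_abs]; congr 1; ring
      _ ≤ |v x| * |e x - κ * h ^ 3 * q| + |v x - v p| * (|κ| * h ^ 3 * |q|) := by
          refine (abs_add_le _ _).trans_eq ?_
          rw [abs_mul, abs_mul (v x - v p), abs_mul _ q, abs_mul κ, abs_of_pos (pow_pos hh 3)]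
      _ ≤ _ := by gcongr; exacts [(abs_nonneg _).trans (hW x hx), hW x hx]
  rw [hsub, ← Real.norm_eq_abs]
  refine (intervalIntegral.norm_integral_le_of_norm_le_const fun x hx =>
    hbound x (uIcc_of_le hle ▸ uIoc_subset_uIcc hx)).trans_eq ?_
  rw [add_sub_cancel_left, abs_of_pos hh]
  ring

theorem continuousOn_interpError {s : Set ℝ} (hf : ContinuousOn f s) (hh : 0 < meshSize a b M) :
    ContinuousOn (fun x => f x - lineInterp a b M f x) s :=
  hf.sub (continuous_lineInterp hh f).continuousOn

theorem HasC4Bound.abs_integral_mul_interpError_cell_le (hf : HasC4Bound f a b K) (hab : a < b)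
    (hM : 1 ≤ M) {n : ℕ} (hn : n < M) (hp : p = a + n * meshSize a b M)
    (hv : BoundedVariationOn v (Icc a b)) (hW : ∀ x ∈ Icc a b, |v x| ≤ W) :
    |∫ x in p..p + meshSize a b M, v x * (f x - lineInterp a b M f x)| ≤ K * meshSize a b M ^ 4 *
      (meshSize a b M * W + (eVariationOn v (Icc p (p + meshSize a b M))).toReal) := by
  have hh := meshSize_pos hab hM
  have hsub : Icc p (p + meshSize a b M) ⊆ Icc a b := hp ▸ cell_subset_Icc hab hM hn
  obtain ⟨κ, hκ, hcubic⟩ := (hf.mono (by linarith) hsub).exists_abs_interpError_sub_le hh.le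
  refine abs_integral_mul_cell_le hh hκ
    (continuousOn_interpError (hf.contDiffOn.continuousOn.mono hsub) hh)
    (fun t ht => ?_) (hv.mono hsub) fun x hx => hW x (hsub hx)
  rw [hp, lineInterp_cell hh hn ht, ← hp]
  exact hcubic t ht

theorem HasC4Bound.abs_integral_mul_interpError_le (hf : HasC4Bound f a b K) (hab : a < b)
    (hM : 1 ≤ M) (hv : BoundedVariationOn v (Icc a b)) (hW : ∀ x ∈ Icc a b, |v x| ≤ W) :
    |∫ x in a..b, v x * (f x - lineInterp a b M f x)| ≤
      K * meshSize a b M ^ 4 * ((b - a) * W + (eVariationOn v (Icc a b)).toReal) := by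
  have hh := meshSize_pos hab hM
  obtain ⟨node, hnode⟩ : ∃ node : ℕ → ℝ, ∀ n, node n = a + n * meshSize a b M := ⟨_, fun _ => rfl⟩
  have hsucc (n : ℕ) : node (n + 1) = node n + meshSize a b M := by
    rw [hnode, hnode]; push_cast; ring
  have hfirst : node 0 = a := by rw [hnode, Nat.cast_zero, zero_mul, add_zero]
  have hlast : node M = b := by rw [hnode, natCast_mul_meshSize hM, add_sub_cancel]
  have hmono : Monotone node := monotone_nat_of_le_succ fun n => by linarith [hsucc n]
  have hsub {n : ℕ} (hn : n < M) : Icc (node n) (node (n + 1)) ⊆ Icc a b := by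
    rw [hsucc, hnode]; exact cell_subset_Icc hab hM hn
  have hint {n : ℕ} (hn : n < M) : IntervalIntegrable
      (fun x => v x * (f x - lineInterp a b M f x)) volume (node n) (node (n + 1)) :=
    (intervalIntegrable_of_boundedVariationOn (hmono n.le_succ)
      (hv.mono (hsub hn))).mul_continuousOn
      (continuousOn_interpError (hf.contDiffOn.continuousOn.mono
        (uIcc_of_le (hmono n.le_succ) ▸ hsub hn)) hh)
  have hvar : ∑ n ∈ Finset.range M, (eVariationOn v (Icc (node n) (node (n + 1)))).toReal =
      (eVariationOn v (Icc a b)).toReal := by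
    rw [← ENNReal.toReal_sum fun n hn => hv.mono (hsub (Finset.mem_range.1 hn)),
      eVariationOn.sum' v hmono, hfirst, hlast]
  calc |∫ x in a..b, v x * (f x - lineInterp a b M f x)|
      = |∑ n ∈ Finset.range M,
          ∫ x in node n..node (n + 1), v x * (f x - lineInterp a b M f x)| := by
        rw [intervalIntegral.sum_integral_adjacent_intervals (a := node) fun n hn => hint hn,
          hfirst, hlast]
    _ ≤ ∑ n ∈ Finset.range M, K * meshSize a b M ^ 4 *
          (meshSize a b M * W + (eVariationOn v (Icc (node n) (node (n + 1)))).toReal) := by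
        refine (Finset.abs_sum_le_sum_abs _ _).trans (Finset.sum_le_sum fun n hn => ?_)
        rw [hsucc]
        exact hf.abs_integral_mul_interpError_cell_le hab hM (Finset.mem_range.1 hn) (hnode n) hv hW
    _ = _ := by
        rw [← Finset.mul_sum, Finset.sum_add_distrib, hvar, Finset.sum_const, Finset.card_range,
          nsmul_eq_mul, ← mul_assoc, natCast_mul_meshSize hM]

end WeightedError

section Unimodal

variable {v : ℝ → ℝ} {a b m W : ℝ}

theorem eVariationOn_Icc_le_of_monotoneOn (hv : MonotoneOn v (Icc a b))
    (hW : ∀ x ∈ Icc a b, v x ∈ Icc 0 W) (hab : a ≤ b) :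
    eVariationOn v (Icc a b) ≤ ENNReal.ofReal W := by
  have heq := hv.eVariationOn_eq (left_mem_Icc.2 hab) (right_mem_Icc.2 hab)
  rw [inter_self] at heq
  exact heq.trans_le (ENNReal.ofReal_le_ofReal (by
    linarith [(hW a (left_mem_Icc.2 hab)).1, (hW b (right_mem_Icc.2 hab)).2]))

theorem eVariationOn_Icc_le_of_antitoneOn (hv : AntitoneOn v (Icc a b))
    (hW : ∀ x ∈ Icc a b, v x ∈ Icc 0 W) (hab : a ≤ b) :
    eVariationOn v (Icc a b) ≤ ENNReal.ofReal W := by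
  have hreflect : MonotoneOn (fun x => W - v x) (Icc a b) := fun x hx y hy hxy =>
    sub_le_sub_left (hv hx hy hxy) W
  have heq : eVariationOn (fun x => W - v x) (Icc a b) = eVariationOn v (Icc a b) := by
    simp only [eVariationOn, edist_sub_left]
  rw [← heq]
  exact eVariationOn_Icc_le_of_monotoneOn hreflect
    (fun x hx => ⟨by linarith [(hW x hx).2], by linarith [(hW x hx).1]⟩) hab

theorem eVariationOn_Icc_le_of_unimodal (hleft : MonotoneOn v (Iic m))
    (hright : AntitoneOn v (Ici m)) (hW : ∀ x, v x ∈ Icc 0 W) (a b : ℝ) :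
    eVariationOn v (Icc a b) ≤ ENNReal.ofReal (2 * W) := by
  have hW0 : 0 ≤ W := (hW m).1.trans (hW m).2
  have hsplit := eVariationOn.Icc_add_Icc v (s := univ) (min_le_right a m) (le_max_right b m)
    (mem_univ m)
  simp only [univ_inter] at hsplit
  refine (eVariationOn.mono v (Icc_subset_Icc (min_le_left a m) (le_max_left b m))).trans ?_
  rw [← hsplit, two_mul, ENNReal.ofReal_add hW0 hW0]
  exact add_le_add
    (eVariationOn_Icc_le_of_monotoneOn (hleft.mono Icc_subset_Iic_self) (fun x _ => hW x)
      (min_le_right a m))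
    (eVariationOn_Icc_le_of_antitoneOn (hright.mono Icc_subset_Ici_self) (fun x _ => hW x)
      (le_max_right b m))

end Unimodal

section RadialKernel

variable {a b c d γ y y₀ : ℝ}

/-- The singular kernel `|(x, y)| ^ (-γ)` on the plane, for the Euclidean norm. -/
noncomputable def radialKernel (γ x y : ℝ) : ℝ := (|√(x ^ 2 + y ^ 2)| ^ γ)⁻¹

theorem div_rpow_sqrt_eq_radialKernel_mul (γ x y z : ℝ) :
    z / |√(x ^ 2 + y ^ 2)| ^ γ = radialKernel γ x y * z := div_eq_inv_mul _ _

theorem radialKernel_comm (γ x y : ℝ) : radialKernel γ x y = radialKernel γ y x := by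
  rw [radialKernel, radialKernel, add_comm]

theorem radialKernel_nonneg (γ x y : ℝ) : 0 ≤ radialKernel γ x y := by
  unfold radialKernel; positivity

theorem radialKernel_zero_left (γ y : ℝ) : radialKernel γ 0 y = |y| ^ (-γ) := by
  rw [radialKernel, zero_pow two_ne_zero, zero_add, Real.sqrt_sq_eq_abs, abs_abs,
    Real.rpow_neg (abs_nonneg _)]

theorem radialKernel_le_of_abs_le (hγ : 0 ≤ γ) (hy : y ≠ 0) {x x' : ℝ} (hx : |x| ≤ |x'|) :
    radialKernel γ x' y ≤ radialKernel γ x y := by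
  have : 0 < √(x ^ 2 + y ^ 2) := Real.sqrt_pos.2 (by positivity)
  have hsq : x ^ 2 ≤ x' ^ 2 := sq_le_sq.2 hx
  unfold radialKernel
  gcongr

theorem radialKernel_le (hγ : 0 ≤ γ) (hy : y ≠ 0) (x : ℝ) : radialKernel γ x y ≤ |y| ^ (-γ) := by
  rw [← radialKernel_zero_left]
  exact radialKernel_le_of_abs_le hγ hy (by simp)

theorem eVariationOn_radialKernel_le (hγ : 0 ≤ γ) (hy : y ≠ 0) (x₀ a b : ℝ) :
    eVariationOn (fun x => radialKernel γ (x₀ - x) y) (Icc a b) ≤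
      ENNReal.ofReal (2 * |y| ^ (-γ)) := by
  refine eVariationOn_Icc_le_of_unimodal (m := x₀) (fun x _ x' hx' hxx' => ?_)
    (fun x hx x' _ hxx' => ?_)
    (fun x => ⟨radialKernel_nonneg _ _ _, radialKernel_le hγ hy _⟩) a b
  · rw [mem_Iic] at hx'
    exact radialKernel_le_of_abs_le hγ hy
      (abs_le_abs_of_nonneg (sub_nonneg.2 hx') (sub_le_sub_left hxx' _))
  · rw [mem_Ici] at hx
    refine radialKernel_le_of_abs_le hγ hy ?_
    rw [abs_sub_comm, abs_sub_comm x₀]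
    exact abs_le_abs_of_nonneg (sub_nonneg.2 hx) (sub_le_sub_right hxx' _)

theorem HasC4Bound.abs_integral_radialKernel_mul_interpError_le {f : ℝ → ℝ} {K : ℝ} {M : ℕ}
    (hf : HasC4Bound f a b K) (hab : a < b) (hM : 1 ≤ M) (hγ : 0 ≤ γ) (hy : y ≠ 0) (x₀ : ℝ) :
    |∫ x in a..b, radialKernel γ (x₀ - x) y * (f x - lineInterp a b M f x)| ≤
      K * meshSize a b M ^ 4 * (b - a + 2) * |y| ^ (-γ) := by
  have hK : 0 ≤ K := hf.nonneg hab.le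
  have hh := meshSize_pos hab hM
  have hvar := eVariationOn_radialKernel_le hγ hy x₀ a b
  calc _ ≤ K * meshSize a b M ^ 4 * ((b - a) * |y| ^ (-γ) +
          (eVariationOn (fun x => radialKernel γ (x₀ - x) y) (Icc a b)).toReal) :=
        hf.abs_integral_mul_interpError_le hab hM (hvar.trans_lt ENNReal.ofReal_lt_top).ne
          fun x _ => (abs_of_nonneg (radialKernel_nonneg _ _ _)).trans_le (radialKernel_le hγ hy _)
    _ ≤ K * meshSize a b M ^ 4 * ((b - a) * |y| ^ (-γ) + 2 * |y| ^ (-γ)) := by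
        gcongr
        exact ENNReal.toReal_le_of_le_ofReal (by positivity) hvar
    _ = _ := by ring

theorem intervalIntegrable_abs_rpow_neg (hγ : γ < 1) (p q : ℝ) :
    IntervalIntegrable (fun s : ℝ => |s| ^ (-γ)) volume p q := by
  refine intervalIntegrable_of_even (fun s => by rw [abs_neg]) fun r hr =>
    (intervalIntegral.intervalIntegrable_rpow' (neg_lt_neg hγ)).congr_uIoo fun s hs => ?_
  rw [uIoo_of_le hr.le] at hs
  simp only [abs_of_pos hs.1]

theorem intervalIntegrable_abs_sub_rpow_neg (hγ : γ < 1) (y₀ p q : ℝ) :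
    IntervalIntegrable (fun y => |y₀ - y| ^ (-γ)) volume p q := by
  simpa only [sub_sub_cancel] using
    (intervalIntegrable_abs_rpow_neg hγ (y₀ - p) (y₀ - q)).comp_sub_left y₀

theorem integral_abs_sub_rpow_neg_le (hγ0 : 0 ≤ γ) (hγ1 : γ < 1) (hcd : c ≤ d) (y₀ : ℝ) :
    ∫ y in c..d, |y₀ - y| ^ (-γ) ≤ ∫ s in c - d..d - c, |s| ^ (-γ) := by
  obtain ⟨z, hz, hclose⟩ : ∃ z ∈ Icc c d, ∀ y ∈ Icc c d, |z - y| ≤ |y₀ - y| :=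
    ⟨projIcc c d hcd y₀, Subtype.prop _, fun y hy => by
      simpa only [projIcc_of_mem hcd hy] using abs_projIcc_sub_projIcc (c := y₀) (d := y) hcd⟩
  calc ∫ y in c..d, |y₀ - y| ^ (-γ) ≤ ∫ y in c..d, |z - y| ^ (-γ) := by
        refine intervalIntegral.integral_mono_ae_restrict hcd
          (intervalIntegrable_abs_sub_rpow_neg hγ1 _ _ _)
          (intervalIntegrable_abs_sub_rpow_neg hγ1 _ _ _) ?_
        filter_upwards [ae_restrict_mem measurableSet_Icc,
          ae_restrict_of_ae (Measure.ae_ne volume z)] with y hy hne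
        exact Real.rpow_le_rpow_of_nonpos (abs_pos.2 (sub_ne_zero.2 hne.symm)) (hclose y hy)
          (neg_nonpos.2 hγ0)
    _ = ∫ s in z - d..z - c, |s| ^ (-γ) :=
        intervalIntegral.integral_comp_sub_left (fun s => |s| ^ (-γ)) z
    _ ≤ ∫ s in c - d..d - c, |s| ^ (-γ) :=
        intervalIntegral.integral_mono_interval (by linarith [hz.1]) (by linarith)
          (by linarith [hz.2]) (ae_of_all _ fun s => by positivity)
          (intervalIntegrable_abs_rpow_neg hγ1 _ _)

theorem abs_integral_le_of_abs_le_abs_sub_rpow_neg {F : ℝ → ℝ} {B : ℝ} (hγ0 : 0 ≤ γ) (hγ1 : γ < 1)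
    (hcd : c ≤ d) (hB : 0 ≤ B)
    (hF : ∀ y ∈ Icc c d, y₀ - y ≠ 0 → |F y| ≤ B * |y₀ - y| ^ (-γ)) :
    |∫ y in c..d, F y| ≤ B * ∫ s in c - d..d - c, |s| ^ (-γ) := by
  calc |∫ y in c..d, F y| ≤ ∫ y in c..d, B * |y₀ - y| ^ (-γ) := by
        rw [← Real.norm_eq_abs]
        refine intervalIntegral.norm_integral_le_of_norm_le hcd ?_
          ((intervalIntegrable_abs_sub_rpow_neg hγ1 y₀ c d).const_mul B)
        filter_upwards [Measure.ae_ne volume y₀] with y hne hy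
        exact hF y (Ioc_subset_Icc_self hy) (sub_ne_zero.2 hne.symm)
    _ ≤ B * ∫ s in c - d..d - c, |s| ^ (-γ) := by
        rw [intervalIntegral.integral_const_mul]
        exact mul_le_mul_of_nonneg_left (integral_abs_sub_rpow_neg_le hγ0 hγ1 hcd y₀) hB

theorem integrableOn_radialKernel (hγ0 : 0 ≤ γ) (hγ1 : γ < 1) (hcd : c ≤ d) (a b x₀ y₀ : ℝ) :
    IntegrableOn (fun p : ℝ × ℝ => radialKernel γ (x₀ - p.1) (y₀ - p.2)) (Icc a b ×ˢ Icc c d) := by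
  have hline : IntegrableOn (fun y => |y₀ - y| ^ (-γ)) (Icc c d) :=
    (intervalIntegrable_iff_integrableOn_Icc_of_le hcd).1
      (intervalIntegrable_abs_sub_rpow_neg hγ1 y₀ c d)
  have hdom : IntegrableOn (fun p : ℝ × ℝ => 1 * |y₀ - p.2| ^ (-γ)) (Icc a b ×ˢ Icc c d) := by
    rw [IntegrableOn, Measure.volume_eq_prod, ← Measure.prod_restrict]
    exact (integrable_const (1 : ℝ)).mul_prod hline
  refine hdom.mono' (by unfold radialKernel; exact Measurable.aestronglyMeasurable (by fun_prop)) ?_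
  have hne : ∀ᵐ p : ℝ × ℝ, p.2 ≠ y₀ := by
    rw [Measure.volume_eq_prod]
    exact Measure.quasiMeasurePreserving_snd.ae (Measure.ae_ne volume y₀)
  filter_upwards [ae_restrict_of_ae hne] with p hp
  rw [Real.norm_eq_abs, abs_of_nonneg (radialKernel_nonneg _ _ _), one_mul]
  exact radialKernel_le hγ0 (sub_ne_zero.2 hp.symm) _

end RadialKernel

section Slices

theorem continuousOn_iteratedDerivWithin_slice {𝕜 E F : Type*} [NontriviallyNormedField 𝕜]
    [NormedAddCommGroup E] [NormedSpace 𝕜 E] [NormedAddCommGroup F] [NormedSpace 𝕜 F] {s : Set 𝕜}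
    {t : Set E} (hs : UniqueDiffOn 𝕜 s) (ht : UniqueDiffOn 𝕜 t) {n : ℕ} {u : 𝕜 × E → F}
    (hu : ContDiffOn 𝕜 n u (s ×ˢ t)) :
    ContinuousOn (fun p : 𝕜 × E => iteratedDerivWithin n (fun x => u (x, p.2)) s p.1)
      (s ×ˢ t) := by
  induction n generalizing u with
  | zero => simpa only [iteratedDerivWithin_zero] using hu.continuousOn
  | succ n ih =>
    have hfirst : ContDiffOn 𝕜 n (fun p => fderivWithin 𝕜 u (s ×ˢ t) p (1, 0)) (s ×ˢ t) :=
      (hu.fderivWithin (hs.prod ht) (by norm_cast)).clm_apply contDiffOn_const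
    refine (ih hfirst).congr fun p hp => ?_
    rw [iteratedDerivWithin_succ']
    refine iteratedDerivWithin_congr (fun x hx => ?_) hp.1
    have hslice : HasDerivWithinAt (fun x => (x, p.2)) ((1, 0) : 𝕜 × E) s x :=
      (hasDerivWithinAt_id x s).prodMk (hasDerivWithinAt_const x s p.2)
    have hu' := (hu.differentiableOn (by norm_cast) (x, p.2) ⟨hx, hp.2⟩).hasFDerivWithinAt
    exact (hu'.comp_hasDerivWithinAt x hslice fun z hz => mk_mem_prod hz hp.2).derivWithin
      (hs x hx)

variable {a b c d K : ℝ} {M : ℕ} {u : ℝ × ℝ → ℝ}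

theorem exists_hasC4Bound_slices (hab : a < b) (hcd : c < d)
    (hu : ContDiffOn ℝ 4 u (Icc a b ×ˢ Icc c d)) :
    ∃ K, ∀ y ∈ Icc c d, HasC4Bound (fun x => u (x, y)) a b K := by
  have hcompact : IsCompact (Icc a b ×ˢ Icc c d) := isCompact_Icc.prod isCompact_Icc
  have hcont {n : ℕ} (hn : (n : WithTop ℕ∞) ≤ 4) :=
    continuousOn_iteratedDerivWithin_slice (uniqueDiffOn_Icc hab) (uniqueDiffOn_Icc hcd)
      (hu.of_le hn)
  obtain ⟨K₃, hK₃⟩ := hcompact.exists_bound_of_continuousOn (hcont (n := 3) (by norm_num))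
  obtain ⟨K₄, hK₄⟩ := hcompact.exists_bound_of_continuousOn (hcont (n := 4) (by norm_num))
  refine ⟨max K₃ K₄, fun y hy => ⟨?_, fun x hx => ?_, fun x hx => ?_⟩⟩
  · exact hu.comp (contDiff_prodMk_left y).contDiffOn fun x hx => ⟨hx, hy⟩
  · exact (hK₃ (x, y) ⟨hx, hy⟩).trans (le_max_left _ _)
  · exact (hK₄ (x, y) ⟨hx, hy⟩).trans (le_max_right _ _)

/-- Interpolation in `y` commutes with differentiation in `x`. -/
theorem hasC4Bound_lineInterp_snd (hab : a < b) (hcd : c < d) (hM : 1 ≤ M)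
    (hu : ∀ y ∈ Icc c d, HasC4Bound (fun x => u (x, y)) a b K) {y : ℝ} (hy : y ∈ Icc c d) :
    HasC4Bound (fun x => lineInterp c d M (fun t => u (x, t)) y) a b (5 / 4 * K) := by
  have hnode {l : ℕ} (hl : l ∈ Finset.range (2 * M + 1)) : halfNode c d M l ∈ Icc c d :=
    halfNode_mem_Icc hcd hM (Nat.lt_succ_iff.1 (Finset.mem_range.1 hl))
  have hterm {l : ℕ} (hl : l ∈ Finset.range (2 * M + 1)) : ContDiffOn ℝ 4
      (fun x => quadBasis c d M l y * u (x, halfNode c d M l)) (Icc a b) :=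
    contDiffOn_const.mul (hu _ (hnode hl)).contDiffOn
  have hcomm {n : ℕ} (hn : (n : WithTop ℕ∞) ≤ 4) {x : ℝ} (hx : x ∈ Icc a b) :
      iteratedDerivWithin n (fun x => lineInterp c d M (fun t => u (x, t)) y) (Icc a b) x =
        lineInterp c d M (fun t => iteratedDerivWithin n (fun x => u (x, t)) (Icc a b) x) y := by
    simp only [lineInterp]
    rw [iteratedDerivWithin_fun_sum hx (uniqueDiffOn_Icc hab)
      fun l hl => ((hterm hl).of_le hn).contDiffWithinAt hx]
    simp only [iteratedDerivWithin_const_mul_field]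
  refine ⟨ContDiffOn.sum fun l hl => hterm hl, fun x hx => ?_, fun x hx => ?_⟩
  · rw [hcomm (by norm_num) hx]
    exact abs_lineInterp_le hcd hM (fun t ht => (hu t ht).third_le x hx) hy
  · rw [hcomm (by norm_num) hx]
    exact abs_lineInterp_le hcd hM (fun t ht => (hu t ht).fourth_le x hx) hy

theorem continuousOn_lineInterp_fst (hab : a < b) (hM : 1 ≤ M)
    (hu : ContinuousOn u (Icc a b ×ˢ Icc c d)) :
    ContinuousOn (fun p : ℝ × ℝ => lineInterp a b M (fun x => u (x, p.2)) p.1)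
      (Icc a b ×ˢ Icc c d) := by
  refine continuousOn_finsetSum _ fun l hl => ((continuous_quadBasis (meshSize_pos hab hM) l).comp
    continuous_fst).continuousOn.mul (hu.comp (by fun_prop) fun p hp => ⟨?_, hp.2⟩)
  exact halfNode_mem_Icc hab hM (Nat.lt_succ_iff.1 (Finset.mem_range.1 hl))

theorem continuousOn_lineInterp_snd (hcd : c < d) (hM : 1 ≤ M)
    (hu : ContinuousOn u (Icc a b ×ˢ Icc c d)) :
    ContinuousOn (fun p : ℝ × ℝ => lineInterp c d M (fun y => u (p.1, y)) p.2)
      (Icc a b ×ˢ Icc c d) := by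
  refine continuousOn_finsetSum _ fun l hl => ((continuous_quadBasis (meshSize_pos hcd hM) l).comp
    continuous_snd).continuousOn.mul (hu.comp (by fun_prop) fun p hp => ⟨hp.1, ?_⟩)
  exact halfNode_mem_Icc hcd hM (Nat.lt_succ_iff.1 (Finset.mem_range.1 hl))

end Slices

section Rectangle

variable {a b c d γ K : ℝ} {M : ℕ} {u E : ℝ × ℝ → ℝ}

theorem setIntegral_Icc_prod_Icc {G : Type*} [NormedAddCommGroup G] [NormedSpace ℝ G] (hab : a ≤ b)
    (hcd : c ≤ d) {F : ℝ × ℝ → G} (hF : IntegrableOn F (Icc a b ×ˢ Icc c d)) :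
    ∫ p in Icc a b ×ˢ Icc c d, F p = ∫ y in c..d, ∫ x in a..b, F (x, y) := by
  rw [Measure.volume_eq_prod] at hF ⊢
  rw [← setIntegral_prod_swap, setIntegral_prod (fun z => F z.swap) hF.swap,
    intervalIntegral.integral_of_le hcd, integral_Icc_eq_integral_Ioc]
  simp only [intervalIntegral.integral_of_le hab, integral_Icc_eq_integral_Ioc, Prod.swap_prod_mk]

theorem integrableOn_radialKernel_mul (hγ0 : 0 ≤ γ) (hγ1 : γ < 1) (hcd : c ≤ d)
    (hE : ContinuousOn E (Icc a b ×ˢ Icc c d)) (x₀ y₀ : ℝ) :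
    IntegrableOn (fun p : ℝ × ℝ => radialKernel γ (x₀ - p.1) (y₀ - p.2) * E p)
      (Icc a b ×ˢ Icc c d) :=
  (integrableOn_radialKernel hγ0 hγ1 hcd a b x₀ y₀).mul_continuousOn hE
    (isCompact_Icc.prod isCompact_Icc)

theorem abs_setIntegral_radialKernel_mul_interpError_fst_le (hab : a < b) (hcd : c ≤ d)
    (hγ0 : 0 ≤ γ) (hγ1 : γ < 1) (hM : 1 ≤ M)
    (hcont : ContinuousOn u (Icc a b ×ˢ Icc c d))
    (hslice : ∀ y ∈ Icc c d, HasC4Bound (fun x => u (x, y)) a b K) (x₀ y₀ : ℝ) :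
    |∫ p in Icc a b ×ˢ Icc c d, radialKernel γ (x₀ - p.1) (y₀ - p.2) *
        (u p - lineInterp a b M (fun x => u (x, p.2)) p.1)| ≤
      K * (b - a + 2) * (∫ s in c - d..d - c, |s| ^ (-γ)) * meshSize a b M ^ 4 := by
  have hh := meshSize_pos hab hM
  have hE : ContinuousOn (fun p : ℝ × ℝ => u p - lineInterp a b M (fun x => u (x, p.2)) p.1)
      (Icc a b ×ˢ Icc c d) := hcont.sub (continuousOn_lineInterp_fst hab hM hcont)
  rw [setIntegral_Icc_prod_Icc hab.le hcd (integrableOn_radialKernel_mul hγ0 hγ1 hcd hE x₀ y₀)]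
  have hK : 0 ≤ K := (hslice c (left_mem_Icc.2 hcd)).nonneg hab.le
  have : 0 < b - a := sub_pos.2 hab
  rw [mul_right_comm _ _ (meshSize a b M ^ 4), mul_right_comm K]
  exact abs_integral_le_of_abs_le_abs_sub_rpow_neg hγ0 hγ1 hcd (by positivity) fun y hy hne =>
    (hslice y hy).abs_integral_radialKernel_mul_interpError_le hab hM hγ0 hne x₀

theorem abs_setIntegral_radialKernel_mul_interpError_snd_le (hab : a ≤ b) (hcd : c < d)
    (hγ0 : 0 ≤ γ) (hγ1 : γ < 1) (hM : 1 ≤ M)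
    (hcont : ContinuousOn u (Icc a b ×ˢ Icc c d))
    (hslice : ∀ x ∈ Icc a b, HasC4Bound (fun y => u (x, y)) c d K) (x₀ y₀ : ℝ) :
    |∫ p in Icc a b ×ˢ Icc c d, radialKernel γ (x₀ - p.1) (y₀ - p.2) *
        (u p - lineInterp c d M (fun y => u (p.1, y)) p.2)| ≤
      K * (d - c + 2) * (∫ s in a - b..b - a, |s| ^ (-γ)) * meshSize c d M ^ 4 := by
  have hswap := abs_setIntegral_radialKernel_mul_interpError_fst_le (u := u ∘ Prod.swap) hcd hab
    hγ0 hγ1 hM (hcont.comp continuous_swap.continuousOn fun _ hp => hp.symm) hslice y₀ x₀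
  rw [Measure.volume_eq_prod, ← setIntegral_prod_swap] at hswap
  rw [Measure.volume_eq_prod]
  simpa only [Function.comp_apply, Prod.swap_swap, Prod.fst_swap, Prod.snd_swap, Prod.swap_prod_mk,
    radialKernel_comm γ (y₀ - _)] using hswap

theorem integrableOn_radialKernel_mul_sub_quadInterp (hab : a < b) (hcd : c < d) (hγ0 : 0 ≤ γ)
    (hγ1 : γ < 1) {Mx My : ℕ} (hMx : 1 ≤ Mx) (hMy : 1 ≤ My)
    (hcont : ContinuousOn u (Icc a b ×ˢ Icc c d)) (x₀ y₀ : ℝ) :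
    IntegrableOn (fun p : ℝ × ℝ => radialKernel γ (x₀ - p.1) (y₀ - p.2) *
      (u p - quadInterp a b c d Mx My u p.1 p.2)) (Icc a b ×ˢ Icc c d) :=
  integrableOn_radialKernel_mul hγ0 hγ1 hcd.le (hcont.sub (continuousOn_lineInterp_fst hab hMx
    (continuousOn_lineInterp_snd hcd hMy hcont))) x₀ y₀

theorem abs_setIntegral_radialKernel_mul_sub_quadInterp_le (hab : a < b) (hcd : c < d)
    (hγ0 : 0 ≤ γ) (hγ1 : γ < 1) {Mx My : ℕ} (hMx : 1 ≤ Mx) (hMy : 1 ≤ My) {K₁ K₂ : ℝ}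
    (hcont : ContinuousOn u (Icc a b ×ˢ Icc c d))
    (hslice₁ : ∀ y ∈ Icc c d, HasC4Bound (fun x => u (x, y)) a b K₁)
    (hslice₂ : ∀ x ∈ Icc a b, HasC4Bound (fun y => u (x, y)) c d K₂) (x₀ y₀ : ℝ) :
    |∫ p in Icc a b ×ˢ Icc c d, radialKernel γ (x₀ - p.1) (y₀ - p.2) *
        (u p - quadInterp a b c d Mx My u p.1 p.2)| ≤
      5 / 4 * K₁ * (b - a + 2) * (∫ s in c - d..d - c, |s| ^ (-γ)) * meshSize a b Mx ^ 4 +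
        K₂ * (d - c + 2) * (∫ s in a - b..b - a, |s| ^ (-γ)) * meshSize c d My ^ 4 := by
  set v : ℝ × ℝ → ℝ := fun p => lineInterp c d My (fun y => u (p.1, y)) p.2
  have hv : ContinuousOn v (Icc a b ×ˢ Icc c d) := continuousOn_lineInterp_snd hcd hMy hcont
  have hsplit (p : ℝ × ℝ) : u p - quadInterp a b c d Mx My u p.1 p.2 =
      (v p - lineInterp a b Mx (fun x => v (x, p.2)) p.1) + (u p - v p) := by
    rw [quadInterp_eq_lineInterp, add_comm, sub_add_sub_cancel]
  have hint₁ : IntegrableOn (fun p : ℝ × ℝ => radialKernel γ (x₀ - p.1) (y₀ - p.2) *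
      (v p - lineInterp a b Mx (fun x => v (x, p.2)) p.1)) (Icc a b ×ˢ Icc c d) :=
    integrableOn_radialKernel_mul hγ0 hγ1 hcd.le
      (hv.sub (continuousOn_lineInterp_fst hab hMx hv)) x₀ y₀
  have hint₂ : IntegrableOn (fun p : ℝ × ℝ => radialKernel γ (x₀ - p.1) (y₀ - p.2) *
      (u p - v p)) (Icc a b ×ˢ Icc c d) :=
    integrableOn_radialKernel_mul hγ0 hγ1 hcd.le (hcont.sub hv) x₀ y₀
  simp only [hsplit, mul_add (radialKernel _ _ _)]
  rw [integral_add hint₁ hint₂]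
  exact (abs_add_le _ _).trans <| add_le_add
    (abs_setIntegral_radialKernel_mul_interpError_fst_le hab hcd.le hγ0 hγ1 hMx hv
      (fun _ hy => hasC4Bound_lineInterp_snd hab hcd hMy hslice₁ hy) x₀ y₀)
    (abs_setIntegral_radialKernel_mul_interpError_snd_le hab.le hcd hγ0 hγ1 hMy hcont hslice₂ x₀ y₀)

end Rectangle

theorem endDist_pos {a b : ℝ} (hab : a < b) {M i : ℕ} (hM : 1 ≤ M)
    (hi : i ∈ Finset.Icc 1 (2 * M - 1)) : 0 < endDist a b M i := by
  have := meshSize_pos hab hM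
  have hMh := natCast_mul_meshSize (a := a) (b := b) hM
  obtain ⟨hi1, hi2⟩ := Finset.mem_Icc.1 hi
  have hi1' : (1 : ℝ) ≤ i := by exact_mod_cast hi1
  have hi2' : (i : ℝ) + 1 ≤ 2 * M := by exact_mod_cast (by omega : i + 1 ≤ 2 * M)
  simp only [endDist, halfNode, Int.cast_natCast]
  exact lt_min (by nlinarith) (by nlinarith)

theorem one_le_mul_endDist_rpow {a b γ : ℝ} (hab : a < b) (hγ : 0 ≤ γ) {M i : ℕ} (hM : 1 ≤ M)
    (hi : i ∈ Finset.Icc 1 (2 * M - 1)) : 1 ≤ (b - a) ^ γ * endDist a b M i ^ (-γ) := by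
  have hpos := endDist_pos hab hM hi
  have hiM : i ≤ 2 * M := (Finset.mem_Icc.1 hi).2.trans (Nat.sub_le _ _)
  have hle : endDist a b M i ≤ b - a :=
    (min_le_left _ _).trans (sub_le_sub_right (halfNode_mem_Icc hab hM hiM).2 a)
  rw [Real.rpow_neg hpos.le, ← div_eq_mul_inv, one_le_div (Real.rpow_pos_of_pos hpos _)]
  exact Real.rpow_le_rpow hpos.le hle hγ

theorem exists_mul_meshSize_pow_four_le {a b c d γ C : ℝ} (hab : a < b) (hcd : c < d) (hγ : 0 ≤ γ)
    (hC : 0 ≤ C) :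
    ∃ C' : ℝ, ∀ Mx My : ℕ, 1 ≤ Mx → 1 ≤ My →
      ∀ i ∈ Finset.Icc 1 (2 * Mx - 1), ∀ j ∈ Finset.Icc 1 (2 * My - 1),
        C * (meshSize a b Mx ^ 4 + meshSize c d My ^ 4) ≤
          C' * (meshSize a b Mx ^ 4 * endDist a b Mx i ^ (-γ) +
              meshSize c d My ^ 4 * endDist c d My j ^ (-γ)) +
            C' * (meshSize a b Mx ^ (5 - γ) + meshSize c d My ^ (5 - γ)) := by
  have hx0 := Real.rpow_pos_of_pos (sub_pos.2 hab) γ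
  have hy0 := Real.rpow_pos_of_pos (sub_pos.2 hcd) γ
  refine ⟨C * ((b - a) ^ γ + (d - c) ^ γ), fun Mx My hMx hMy i hi j hj => ?_⟩
  have hx := meshSize_pos hab hMx
  have hy := meshSize_pos hcd hMy
  have hi0 := Real.rpow_pos_of_pos (endDist_pos hab hMx hi) (-γ)
  have hj0 := Real.rpow_pos_of_pos (endDist_pos hcd hMy hj) (-γ)
  calc C * (meshSize a b Mx ^ 4 + meshSize c d My ^ 4)
      ≤ C * (meshSize a b Mx ^ 4 * ((b - a) ^ γ * endDist a b Mx i ^ (-γ)) +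
          meshSize c d My ^ 4 * ((d - c) ^ γ * endDist c d My j ^ (-γ))) := by
        gcongr <;> refine le_mul_of_one_le_right (by positivity) ?_
        exacts [one_le_mul_endDist_rpow hab hγ hMx hi, one_le_mul_endDist_rpow hcd hγ hMy hj]
    _ ≤ C * (meshSize a b Mx ^ 4 * (((b - a) ^ γ + (d - c) ^ γ) * endDist a b Mx i ^ (-γ)) +
          meshSize c d My ^ 4 * (((b - a) ^ γ + (d - c) ^ γ) * endDist c d My j ^ (-γ))) := by
        gcongr
        exacts [le_add_of_nonneg_right hy0.le, le_add_of_nonneg_left hx0.le]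
    _ = C * ((b - a) ^ γ + (d - c) ^ γ) * (meshSize a b Mx ^ 4 * endDist a b Mx i ^ (-γ) +
          meshSize c d My ^ 4 * endDist c d My j ^ (-γ)) := by ring
    _ ≤ _ := le_add_of_nonneg_right (by positivity)

theorem lemma3p12_general {a b c d γ : ℝ} (hab : a < b) (hcd : c < d) (hγ0 : 0 ≤ γ) (hγ1 : γ < 1)
    {u : ℝ × ℝ → ℝ} (hu : ContDiffOn ℝ 4 u (Icc a b ×ˢ Icc c d)) :
    ∃ C : ℝ, 0 ≤ C ∧ ∀ Mx My : ℕ, 1 ≤ Mx → 1 ≤ My → ∀ x₀ y₀ : ℝ,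
      IntegrableOn (fun p : ℝ × ℝ => (u p - quadInterp a b c d Mx My u p.1 p.2) /
        |√((x₀ - p.1) ^ 2 + (y₀ - p.2) ^ 2)| ^ γ) (Icc a b ×ˢ Icc c d) ∧
      |∫ y in c..d, ∫ x in a..b, (u (x, y) - quadInterp a b c d Mx My u x y) /
          |√((x₀ - x) ^ 2 + (y₀ - y) ^ 2)| ^ γ| ≤
        C * (meshSize a b Mx ^ 4 + meshSize c d My ^ 4) := by
  obtain ⟨K₁, hslice₁⟩ := exists_hasC4Bound_slices hab hcd hu
  obtain ⟨K₂, hslice₂⟩ := exists_hasC4Bound_slices hcd hab (u := u ∘ Prod.swap)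
    (hu.comp (contDiff_snd.prodMk contDiff_fst).contDiffOn fun _ hp => hp.symm)
  refine ⟨max 0 (max (5 / 4 * K₁ * (b - a + 2) * ∫ s in c - d..d - c, |s| ^ (-γ))
    (K₂ * (d - c + 2) * ∫ s in a - b..b - a, |s| ^ (-γ))), le_max_left _ _,
    fun Mx My hMx hMy x₀ y₀ => ?_⟩
  simp only [div_rpow_sqrt_eq_radialKernel_mul]
  have hint := integrableOn_radialKernel_mul_sub_quadInterp hab hcd hγ0 hγ1 hMx hMy hu.continuousOn
    x₀ y₀
  refine ⟨hint, (congrArg abs (setIntegral_Icc_prod_Icc hab.le hcd.le hint)).symm.trans_le ?_⟩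
  refine (abs_setIntegral_radialKernel_mul_sub_quadInterp_le hab hcd hγ0 hγ1 hMx hMy
    hu.continuousOn hslice₁ hslice₂ x₀ y₀).trans ?_
  rw [mul_add (max _ _)]
  gcongr <;> simp only [le_max_iff, le_refl, true_or, or_true]

theorem lemma3p12 (a b c d γ : ℝ) (hab : a < b) (hcd : c < d) (hγ0 : 0 < γ) (hγ1 : γ < 1)
    (u : ℝ × ℝ → ℝ) (hu : ContDiffOn ℝ 6 u (Set.Icc a b ×ˢ Set.Icc c d)) :
    ∃ C : ℝ, ∀ Mx My : ℕ, 1 ≤ Mx → 1 ≤ My →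
      ∀ i ∈ Finset.Icc 1 (2 * Mx - 1), ∀ j ∈ Finset.Icc 1 (2 * My - 1),
        MeasureTheory.IntegrableOn
          (fun p : ℝ × ℝ => additiveErrorIntegrand a b c d γ Mx My u i j p.1 p.2)
          (Set.Icc a b ×ˢ Set.Icc c d) ∧
        |∫ y in c..d, ∫ x in a..b, additiveErrorIntegrand a b c d γ Mx My u i j x y| ≤
          C * (meshSize a b Mx ^ 4 * endDist a b Mx i ^ (-γ) +
              meshSize c d My ^ 4 * endDist c d My j ^ (-γ)) +
            C * (meshSize a b Mx ^ (5 - γ) + meshSize c d My ^ (5 - γ)) := by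
  obtain ⟨C, hC0, hC⟩ := lemma3p12_general hab hcd hγ0.le hγ1 (hu.of_le (by norm_num))
  obtain ⟨C', hC'⟩ := exists_mul_meshSize_pow_four_le hab hcd hγ0.le hC0
  exact ⟨C', fun Mx My hMx hMy i hi j hj =>
    (hC Mx My hMx hMy _ _).imp_right (·.trans (hC' Mx My hMx hMy i hi j hj))⟩
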